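/- **Games.** Consider a finite extensive-form game with a nonempty finite set of players $N$, possibly with nature $c$, imperfect information, simultaneous moves, and perfect recall. It consists of: a finite set $H$ of finite sequences of action profiles (histories) that contains the empty sequence and all subhistories of its members, with set of terminal histories $Z$; for each $h\in H\setminus Z$ a nonempty set $P(h)\subseteq N\cup\{c\}$ of movers and a nonempty set $A_i(h)$ of actions for each $i\in P(h)$, the successors of $h$ being exactly the $(h,a)$ with $a\in\prod_{i\in P(h)}A_i(h)$; for each $i\in N$ a partition $\mathcal I_i$ (information sets) of $\{h\in H\setminus Z: i\in P(h)\}$ such that $A_i(\cdot)$ is constant on each information set; and utilities $u_i:Z\to\mathbb R$, $i\in N$. Nature's information sets are singletons. Perfect recall means that for each $i\in N$ any two histories in the same information set of $i$ pass through the same sequence of information sets of $i$ with the same actions of $i$ taken there. A strategy $s_i\in S_i$ assigns to each information set of $i$ an action available there (this includes $i=c$); $S_{-i}$ is the set of profiles of strategies of all other players including nature; $z(s)\in Z$ is the terminal history reached by the profile $s$, and $Z(S')=\{z(s):s\in S'\}$ for a set $S'$ of strategy profiles. A profile $s$ reaches $I_i\in\mathcal I_i$ if some history in $I_i$ is a subhistory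 of $z(s)$; $s_i$ (resp. $s_{-i}$) reaches $I_i$ if $(s_i,s_{-i})$ does for some $s_{-i}$ (resp. some $s_i$). Let $S_{-i}(I_i)$ be the set of $s_{-i}$ that reach $I_i$. An information set $I_i$ strictly precedes $I_i'$ if some history in $I_i$ is a proper subhistory of one in $I'_i$. **Belief systems.** A belief system of $i\in N$ is a family $\bar\beta_i=(\bar\beta_i(I_i))_{I_i\in\mathcal I_i}$ of probability measures on $S_{-i}$ such that $\bar\beta_i(I_i)(S_{-i}(I_i))=1$, and such that if $I_i$ strictly precedes $I_i'$ and $\bar\beta_i(I_i)(S_{-i}(I'_i))>0$, then $\bar\beta_i(I_i')=\bar\beta_i(I_i)(\,\cdot\mid S_{-i}(I_i'))$. It has full support if the support of $\bar\beta_i(I_i)$ is $S_{-i}(I_i)$ for every $I_i$. A strategy $s_i$ is rational at $I_i$ with $\bar\beta_i$ if either $s_i$ does not reach $I_i$, or no strategy of $i$ that agrees with $s_i$ on all information sets of $i$ strictly preceding $I_i$ yields $i$ a strictly higher expected utility under $\bar\beta_i(I_i)$. **Strong level-$k$ thinking.** Fix a profile of belief systems $\bar\beta^1=(\bar\beta^1_i)_{i\in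 N}$. Let $\bar L^k_c(\bar\beta^1)=S_c$ for nature (which is indifferent among all terminal histories), and write $\bar L^{\ell}_{-i}$ for the product of the sets $\bar L^\ell_j$, $j\ne i$ (including $j=c$). For $i\in N$ put $\bar B^1_i=\{\bar\beta^1_i\}$; for $k\ge2$ let $\bar B_i^k$ be the set of belief systems $\bar\beta_i$ of $i$ such that for every $I_i\in\mathcal I_i$: if $I_i$ is reached by some $s_{-i}\in\bar L^{\ell}_{-i}$ with $1\le\ell<k$, then $\bar\beta_i(I_i)(\bar L_{-i}^{\bar\ell})=1$ for the largest such $\ell=\bar\ell$; otherwise $\bar\beta_i(I_i)=\bar\beta_i^1(I_i)$. For $k\ge1$, $\bar L^k_i(\bar\beta^1)$ is the set of $s_i\in S_i$ for which there is $\bar\beta_i\in\bar B^k_i$ such that $s_i$ is rational at every $I_i\in\mathcal I_i$ with $\bar\beta_i$. Let $\bar L^k(\bar\beta^1)$ be the product of all $\bar L^k_j(\bar\beta^1)$, $j\in N\cup\{c\}$. **Normal-form level-$k$ thinking.** The associated normal form has action sets $S_j$, $j\in N\cup\{c\}$, and utilities $s\mapsto u_i(z(s))$, $i\in N$. Given probability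 measures $\beta^1_i$ on $S_{-i}$, $i\in N$, let $L^k_c(\beta^1)=S_c$; let $L_i^1(\beta^1)$ be the set of $s_i$ maximizing $i$'s expected utility over $S_i$ under $\beta_i^1$, and for $k\ge2$ let $L_i^k(\beta^1)$ be the set of $s_i$ maximizing $i$'s expected utility over $S_i$ under some probability measure $\beta_i$ on $S_{-i}$ with $\beta_i(L_{-i}^{k-1}(\beta^1))=1$. Let $L^k(\beta^1)$ be the product of all $L^k_j(\beta^1)$, $j\in N\cup\{c\}$. The profile $\beta^1$ has full support if each $\beta_i^1$ has support $S_{-i}$, and it is consistent with $\bar\beta^1$ if $\bar\beta^1_i(I_i)=\beta_i^1(\,\cdot\mid S_{-i}(I_i))$ for all $i\in N$ and $I_i\in\mathcal I_i$. **Proposition.** Let $\bar\beta^1$ be a profile of full-support belief systems in such a game and let $\beta^1$ be a profile of full-support beliefs in the associated normal form that is consistent with $\bar\beta^1$. Then for every $k\ge1$, $$Z(\bar L^k(\bar\beta^1))\subseteq Z(L^k(\beta^1)).$$ -/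

import Mathlib

universe u v

/-!
### Profiles and beliefs

`N` is the set of players. `Option N` is `N` together with nature, which is the element `none`;
player `i` is the element `some i`.
-/

/-- Profiles of everybody but player `i` (the opponents of `i`, including nature). -/
abbrev OppProfile {N : Type u} (S : Option N → Type v) (i : N) : Type (max u v) :=
  (j : {j : Option N // j ≠ some i}) → S j

open Classical in
/-- The profile `(sᵢ, s₋ᵢ)`. -/
noncomputable def joinProfile {N : Type u} {S : Option N → Type v} (i : N)
    (x : S (some i)) (t : OppProfile S i) : (j : Option N) → S j :=
  fun j => if h : j = some i then h ▸ x else t ⟨j, h⟩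

/-- The product `L₋ᵢ` of the sets `L j` over all `j` different from `i`. -/
def oppSet {N : Type u} {S : Option N → Type v} (L : (j : Option N) → Set (S j)) (i : N) :
    Set (OppProfile S i) :=
  {t | ∀ j : {j : Option N // j ≠ some i}, t j ∈ L j}

/-- The expectation of `f` under the probability distribution `p` (it is only used on finite
types). -/
noncomputable def expectation {T : Type u} (p : PMF T) (f : T → ℝ) : ℝ :=
  ∑' t, (p t).toReal * f t

/-- `p` assigns probability one to `E`. -/
def CertainOf {T : Type u} (p : PMF T) (E : Set T) : Prop :=
  p.toOuterMeasure E = 1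

/-- `q` is `p` conditional on `E`, whenever `p` gives positive probability to `E`. -/
def DerivedByConditioning {T : Type u} (p q : PMF T) (E : Set T) : Prop :=
  ∀ h : ∃ t ∈ E, t ∈ p.support, q = p.filter E h

/-! ### Games in normal form and level-`k` thinking -/

/-- A finite game in normal form with player set `N`. Nature may take part as an additional
player, without preferences; a game without nature is one where nature has a single action. -/
structure NormalFormGame (N : Type u) where
  Act : Option N → Type v
  act_finite : ∀ j, Finite (Act j)
  act_nonempty : ∀ j, Nonempty (Act j)
  util : N → ((j : Option N) → Act j) → ℝ

namespace NormalFormGame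

variable {N : Type u} (Γ : NormalFormGame.{u, v} N)

/-- A belief of player `i` over the actions of the others. -/
abbrev Belief (i : N) := PMF (OppProfile Γ.Act i)

noncomputable def expectedUtil (i : N) (x : Γ.Act (some i)) (β : Γ.Belief i) : ℝ :=
  expectation β fun t => Γ.util i (joinProfile i x t)

/-- `x` maximizes the expected utility of player `i` given the belief `β`. -/
def Rational (i : N) (x : Γ.Act (some i)) (β : Γ.Belief i) : Prop :=
  ∀ y, Γ.expectedUtil i y β ≤ Γ.expectedUtil i x β

/-- The sets `Lⱼᵏ(β¹)` of level-`k` thinking actions, for `k ≥ 1` (the value at `k = 0` is a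
dummy). Nature is indifferent between all outcomes, so that all of its actions qualify. -/
def level (β₁ : (i : N) → Γ.Belief i) : ℕ → (j : Option N) → Set (Γ.Act j)
  | 0, _ => Set.univ
  | _ + 1, none => Set.univ
  | 1, some i => {x | Γ.Rational i x (β₁ i)}
  | k + 2, some i =>
      {x | ∃ β : Γ.Belief i,
        CertainOf β (oppSet (fun j => level β₁ (k + 1) j) i) ∧ Γ.Rational i x β}

end NormalFormGame

/-! ### Games in extensive form -/

/-- An action profile: `a j = some x` if `j` moves and plays `x`, `a j = none` if `j` does not
move. -/
abbrev ActionProfile (N : Type u) (A : Type v) := Option N → Option A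

/-- A history is a finite sequence of action profiles, listed from the most recent one to the
oldest one. Thus `a :: h` is the history `h` followed by `a`, and the subhistories (initial
segments) of `h` are the list suffixes of `h`. -/
abbrev History (N : Type u) (A : Type v) := List (ActionProfile N A)

/-- `h` belongs to `H` and has a successor in `H`. -/
def NonterminalIn {N : Type u} {A : Type v} (H : Set (History N A)) (h : History N A) : Prop :=
  h ∈ H ∧ ∃ a, a :: h ∈ H

/-- `h` belongs to `H` and has no successor in `H`. -/
def TerminalIn {N : Type u} {A : Type v} (H : Set (History N A)) (h : History N A) : Prop :=
  h ∈ H ∧ ¬ ∃ a, a :: h ∈ H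

/-- A finite game in extensive form with player set `N`, possibly with imperfect information,
simultaneous moves and moves of nature. -/
structure ExtensiveGame (N : Type u) (A : Type v) where
  /-- the set of histories -/
  H : Set (History N A)
  finite_H : H.Finite
  nil_mem : [] ∈ H
  mem_of_cons_mem : ∀ a h, a :: h ∈ H → h ∈ H
  /-- the players (possibly including nature) who move at a nonterminal history -/
  P : History N A → Set (Option N)
  P_nonempty : ∀ h, NonterminalIn H h → (P h).Nonempty
  /-- the actions available to those who move at a nonterminal history -/
  avail : Option N → History N A → Set A
  avail_nonempty : ∀ h, NonterminalIn H h → ∀ j ∈ P h, (avail j h).Nonempty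
  /-- the successors of a nonterminal history are given by the available action profiles -/
  cons_mem_iff : ∀ h, NonterminalIn H h → ∀ a, a :: h ∈ H ↔
    ∀ j, (j ∈ P h → ∃ x ∈ avail j h, a j = some x) ∧ (j ∉ P h → a j = none)
  /-- the information sets of a player: a partition of the nonterminal histories at which she
  moves, with the same actions available throughout an information set -/
  info : N → Set (Set (History N A))
  info_nonempty : ∀ i, ∀ I ∈ info i, I.Nonempty
  info_subset : ∀ i, ∀ I ∈ info i, ∀ h ∈ I, NonterminalIn H h ∧ some i ∈ P h
  info_cover : ∀ i h, NonterminalIn H h → some i ∈ P h → ∃! I, I ∈ info i ∧ h ∈ I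
  avail_eq : ∀ i, ∀ I ∈ info i, ∀ h ∈ I, ∀ h' ∈ I, avail (some i) h = avail (some i) h'
  /-- the Bernoulli utility indices on terminal histories -/
  util : N → {z // TerminalIn H z} → ℝ

namespace ExtensiveGame

variable {N : Type u} {A : Type v} (G : ExtensiveGame N A)

/-- Terminal histories. -/
abbrev Terminal := {z // TerminalIn G.H z}

/-- The information sets of a player or of nature; those of nature are singletons. -/
def infoSets : Option N → Set (Set (History N A))
  | some i => G.info i
  | none => {I | ∃ h, NonterminalIn G.H h ∧ none ∈ G.P h ∧ I = {h}}

/-- The information set of `j` that contains `h` (the empty set if there is none). -/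
def cell (j : Option N) (h : History N A) : Set (History N A) :=
  {h' | ∃ I ∈ G.infoSets j, h ∈ I ∧ h' ∈ I}

/-- The actions available to `j` at the information set `I`. -/
def availAt (j : Option N) (I : Set (History N A)) : Set A :=
  {x | ∃ h ∈ I, x ∈ G.avail j h}

/-- The experience of player `i` along a history: the information sets of `i` through which it
passes, with the actions that `i` takes there, in their order (most recent first). -/
def experience (i : N) : History N A → List (Set (History N A) × A)
  | [] => []
  | a :: h =>
    match a (some i) with
    | none => experience i h
    | some x => (G.cell (some i) h, x) :: experience i h

/-- Perfect recall: two histories in the same information set of a player give this player the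
same experience. -/
def PerfectRecall : Prop :=
  ∀ i : N, ∀ I ∈ G.info i, ∀ h ∈ I, ∀ h' ∈ I, G.experience i h = G.experience i h'

/-- The strategies of `j`: an available action for every information set. -/
abbrev Strategy (j : Option N) : Type (max u v) :=
  (I : {I // I ∈ G.infoSets j}) → {x // x ∈ G.availAt j I.1}

/-- Strategy profiles (including nature's strategy). -/
abbrev Profile : Type (max u v) := (j : Option N) → G.Strategy j

/-- Profiles of strategies of everybody but player `i`. -/
abbrev Opp (i : N) : Type (max u v) := OppProfile G.Strategy i

open Classical in
/-- The action profile that the strategy profile `s` prescribes at `h`. -/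
noncomputable def prescribed (s : G.Profile) (h : History N A) : ActionProfile N A :=
  fun j => if hj : G.cell j h ∈ G.infoSets j then some (s j ⟨G.cell j h, hj⟩).1 else none

open Classical in
/-- The history that is reached by `s` after `n` moves, or earlier if play ends before. -/
noncomputable def path (s : G.Profile) : ℕ → History N A
  | 0 => []
  | n + 1 => if NonterminalIn G.H (path s n) then G.prescribed s (path s n) :: path s n
      else path s n

theorem infoSets_subset {j : Option N} {I : Set (History N A)} (hI : I ∈ G.infoSets j)
    {h : History N A} (hh : h ∈ I) : NonterminalIn G.H h ∧ j ∈ G.P h := by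
  cases j with
  | none =>
    obtain ⟨g, hg, hP, rfl⟩ := hI
    obtain rfl : h = g := hh
    exact ⟨hg, hP⟩
  | some i => exact G.info_subset i I hI h hh

theorem infoSets_nonempty {j : Option N} {I : Set (History N A)} (hI : I ∈ G.infoSets j) :
    I.Nonempty := by
  cases j with
  | none =>
    obtain ⟨g, hg, hP, rfl⟩ := hI
    exact ⟨g, rfl⟩
  | some i => exact G.info_nonempty i I hI

theorem infoSets_avail {j : Option N} {I : Set (History N A)} (hI : I ∈ G.infoSets j)
    {h : History N A} (hh : h ∈ I) : G.availAt j I = G.avail j h := by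
  ext x
  refine ⟨?_, fun hx => ⟨h, hh, hx⟩⟩
  rintro ⟨h', hh', hx⟩
  cases j with
  | none =>
    obtain ⟨g, hg, hP, rfl⟩ := hI
    obtain rfl : h = g := hh
    obtain rfl : h' = h := hh'
    exact hx
  | some i => rwa [G.avail_eq i I hI h hh h' hh']

theorem cell_eq {j : Option N} {I : Set (History N A)} (hI : I ∈ G.infoSets j)
    {h : History N A} (hh : h ∈ I) : G.cell j h = I := by
  ext h'
  refine ⟨?_, fun hx => ⟨I, hI, hh, hx⟩⟩
  rintro ⟨J, hJ, hhJ, hx⟩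
  suffices I = J by rwa [this]
  cases j with
  | none =>
    obtain ⟨g, hg, hP, rfl⟩ := hI
    obtain ⟨g', hg', hP', rfl⟩ := hJ
    obtain rfl : h = g := hh
    obtain rfl : h = g' := hhJ
    rfl
  | some i =>
    obtain ⟨hn, hP⟩ := G.info_subset i I hI h hh
    exact (G.info_cover i h hn hP).unique ⟨hI, hh⟩ ⟨hJ, hhJ⟩

theorem exists_infoSet {j : Option N} {h : History N A} (hn : NonterminalIn G.H h)
    (hP : j ∈ G.P h) : ∃ I ∈ G.infoSets j, h ∈ I := by
  cases j with
  | none => exact ⟨{h}, ⟨h, hn, hP, rfl⟩, rfl⟩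
  | some i =>
    obtain ⟨I, ⟨hI, hh⟩, -⟩ := G.info_cover i h hn hP
    exact ⟨I, hI, hh⟩

theorem cons_prescribed_mem (s : G.Profile) {h : History N A} (hn : NonterminalIn G.H h) :
    G.prescribed s h :: h ∈ G.H := by
  rw [G.cons_mem_iff h hn]
  intro j
  constructor
  · intro hP
    obtain ⟨I, hI, hh⟩ := G.exists_infoSet hn hP
    have hc : G.cell j h ∈ G.infoSets j := by rwa [G.cell_eq hI hh]
    have hm : h ∈ G.cell j h := ⟨I, hI, hh, hh⟩
    refine ⟨(s j ⟨G.cell j h, hc⟩).1, ?_, ?_⟩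
    · rw [← G.infoSets_avail hc hm]
      exact (s j ⟨G.cell j h, hc⟩).2
    · simp [prescribed, hc]
  · intro hP
    have hc : G.cell j h ∉ G.infoSets j := by
      intro hc
      obtain ⟨h', I, hI, hh, -⟩ := G.infoSets_nonempty hc
      exact hP (G.infoSets_subset hI hh).2
    simp [prescribed, hc]

theorem path_mem (s : G.Profile) (n : ℕ) : G.path s n ∈ G.H := by
  induction n with
  | zero => exact G.nil_mem
  | succ n ih =>
    rw [path]
    split_ifs with hn
    · exact G.cons_prescribed_mem s hn
    · exact ih

theorem path_terminal_or_length (s : G.Profile) (n : ℕ) :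
    TerminalIn G.H (G.path s n) ∨ ∀ m ≤ n, (G.path s m).length = m := by
  induction n with
  | zero =>
    right
    intro m hm
    obtain rfl : m = 0 := by omega
    rfl
  | succ n ih =>
    by_cases hn : NonterminalIn G.H (G.path s n)
    · right
      intro m hm
      have ih' := ih.resolve_left fun h => h.2 hn.2
      rcases Nat.lt_or_ge m (n + 1) with h | h
      · exact ih' m (by omega)
      · obtain rfl : m = n + 1 := by omega
        rw [path, if_pos hn, List.length_cons, ih' n le_rfl]
    · left
      rw [path, if_neg hn]
      exact ⟨G.path_mem s n, fun h => hn ⟨G.path_mem s n, h⟩⟩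

theorem path_terminal (s : G.Profile) : TerminalIn G.H (G.path s G.H.ncard) := by
  refine (G.path_terminal_or_length s _).resolve_right fun h => ?_
  have hinj : Set.InjOn (G.path s) (Set.Iic G.H.ncard) := by
    intro m hm n hn hmn
    rw [← h m hm, ← h n hn, hmn]
  have hle : (G.path s '' Set.Iic G.H.ncard).ncard ≤ G.H.ncard := by
    refine Set.ncard_le_ncard ?_ G.finite_H
    rintro _ ⟨m, -, rfl⟩
    exact G.path_mem s m
  rw [Set.InjOn.ncard_image hinj] at hle
  rw [← Finset.coe_Iic, Set.ncard_coe_finset, Nat.card_Iic] at hle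
  omega

/-- The terminal history `z(s)` reached by the strategy profile `s`. -/
noncomputable def outcome (s : G.Profile) : G.Terminal :=
  ⟨G.path s G.H.ncard, G.path_terminal s⟩

/-- The set `Z(S')` of terminal histories reached by strategy profiles in `S'`. -/
def outcomes (S' : Set G.Profile) : Set G.Terminal :=
  {z | ∃ s ∈ S', z = G.outcome s}

/-- The strategy profile `s` reaches the set `I` of histories. -/
def Reaches (s : G.Profile) (I : Set (History N A)) : Prop :=
  ∃ h ∈ I, h <:+ (G.outcome s).1

/-- The strategy `sᵢ` of player `i` reaches `I`. -/
def OwnReaches (i : N) (x : G.Strategy (some i)) (I : Set (History N A)) : Prop :=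
  ∃ t : G.Opp i, G.Reaches (joinProfile i x t) I

/-- The profiles `s₋ᵢ` of strategies of the others that reach `I`. -/
def oppReaching (i : N) (I : Set (History N A)) : Set (G.Opp i) :=
  {t | ∃ x : G.Strategy (some i), G.Reaches (joinProfile i x t) I}

/-- `I` strictly precedes `J`: some history in `I` is a proper subhistory of one in `J`. -/
def Precedes (I J : Set (History N A)) : Prop :=
  ∃ h ∈ I, ∃ h' ∈ J, h <:+ h' ∧ h ≠ h'

/-- Belief systems of player `i`. -/
structure BeliefSystem (i : N) where
  belief : {I // I ∈ G.info i} → PMF (G.Opp i)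
  reaches : ∀ I, CertainOf (belief I) (G.oppReaching i I.1)
  conditioning : ∀ I J, Precedes I.1 J.1 →
    DerivedByConditioning (belief I) (belief J) (G.oppReaching i J.1)

/-- A belief system has full support if at every information set it gives positive probability
to each profile of strategies of the others that reaches this information set. -/
def BeliefSystem.FullSupport {G : ExtensiveGame N A} {i : N} (b : G.BeliefSystem i) : Prop :=
  ∀ I, (b.belief I).support = G.oppReaching i I.1

noncomputable def expectedUtil (i : N) (x : G.Strategy (some i)) (β : PMF (G.Opp i)) : ℝ :=
  expectation β fun t => G.util i (G.outcome (joinProfile i x t))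

/-- `y` is an `I`-replacement of `x`: they agree on all information sets strictly preceding
`I`. -/
def IsReplacement (i : N) (I : Set (History N A)) (x y : G.Strategy (some i)) : Prop :=
  ∀ J : {J // J ∈ G.info i}, Precedes J.1 I → y J = x J

/-- The strategy `x` is rational for player `i` at the information set `I` with the belief
system `b`. -/
def RationalAt (i : N) (x : G.Strategy (some i)) (b : G.BeliefSystem i)
    (I : {I // I ∈ G.info i}) : Prop :=
  ¬ G.OwnReaches i x I.1 ∨
    ¬ ∃ y, G.IsReplacement i I.1 x y ∧
      G.expectedUtil i x (b.belief I) < G.expectedUtil i y (b.belief I)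

/-- The belief systems of player `i` that assign at each information set the highest possible
level below `k` to the others, where `L ℓ` are the strong level-`ℓ` strategies for
`1 ≤ ℓ < k`, and that coincide with the first-level beliefs where no level is possible. For
`k = 1` there is no such `ℓ`, and the only element is the first-level belief system `b₁`. -/
def strongBeliefs (i : N) (b₁ : G.BeliefSystem i) (k : ℕ)
    (L : (ℓ : ℕ) → ℓ < k → (j : Option N) → Set (G.Strategy j)) : Set (G.BeliefSystem i) :=
  {b | ∀ I : {I // I ∈ G.info i},
    (∀ (ℓ : ℕ) (hℓ : ℓ < k),
      IsGreatest {m | 1 ≤ m ∧ ∃ hm : m < k, ∃ t ∈ oppSet (L m hm) i, t ∈ G.oppReaching i I.1} ℓ →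
        CertainOf (b.belief I) (oppSet (L ℓ hℓ) i)) ∧
    ((¬ ∃ m, 1 ≤ m ∧ ∃ hm : m < k, ∃ t ∈ oppSet (L m hm) i, t ∈ G.oppReaching i I.1) →
      b.belief I = b₁.belief I)}

/-- The sets of strong level-`k` thinking strategies, for `k ≥ 1` (the value at `k = 0` is a
dummy). Nature is indifferent between all outcomes, so that all of its strategies qualify. -/
def strongLevel (b₁ : (i : N) → G.BeliefSystem i) (k : ℕ) : (j : Option N) → Set (G.Strategy j)
  | none => Set.univ
  | some i =>
      {x | ∃ b ∈ G.strongBeliefs i (b₁ i) k (fun ℓ _ j => strongLevel b₁ ℓ j),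
        ∀ I, G.RationalAt i x b I}
termination_by k

/-! ### The associated normal form -/

theorem finite_availAt {j : Option N} {I : Set (History N A)} (hI : I ∈ G.infoSets j) :
    (G.availAt j I).Finite := by
  classical
  obtain ⟨h, hh⟩ := G.infoSets_nonempty hI
  obtain ⟨hn, hP⟩ := G.infoSets_subset hI hh
  rw [G.infoSets_avail hI hh]
  obtain ⟨a, ha⟩ := hn.2
  refine Set.Finite.of_injOn (f := fun x => Function.update a j (some x) :: h) (t := G.H)
    ?_ ?_ G.finite_H
  · intro x hx
    rw [G.cons_mem_iff h hn] at ha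
    refine (G.cons_mem_iff h hn _).2 fun j' => ?_
    by_cases hj : j' = j
    · subst hj
      exact ⟨fun _ => ⟨x, hx, by simp⟩, fun h' => absurd hP h'⟩
    · simpa [Function.update_of_ne hj] using ha j'
  · intro x _ y _ hxy
    have := congrFun (List.cons.inj hxy).1 j
    simpa using this

theorem finite_infoSets (j : Option N) : (G.infoSets j).Finite :=
  G.finite_H.finite_subsets.subset fun _ hI _ hh => (G.infoSets_subset hI hh).1.1

instance finite_strategy (j : Option N) : Finite (G.Strategy j) := by
  have := (G.finite_infoSets j).to_subtype
  have : ∀ I : {I // I ∈ G.infoSets j}, Finite {x // x ∈ G.availAt j I.1} :=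
    fun I => (G.finite_availAt I.2).to_subtype
  infer_instance

instance nonempty_strategy (j : Option N) : Nonempty (G.Strategy j) := by
  refine ⟨fun I => Classical.choice ?_⟩
  obtain ⟨h, hh⟩ := G.infoSets_nonempty I.2
  obtain ⟨hn, hP⟩ := G.infoSets_subset I.2 hh
  obtain ⟨x, hx⟩ := G.avail_nonempty h hn j hP
  exact ⟨x, h, hh, hx⟩

/-- The associated normal form: the actions are the strategies, and utilities are evaluated at
the terminal histories that are reached. -/
noncomputable def normalForm : NormalFormGame.{u, max u v} N where
  Act := G.Strategy
  act_finite := G.finite_strategy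
  act_nonempty := G.nonempty_strategy
  util i s := G.util i (G.outcome s)

/-- A belief in the associated normal form is consistent with a belief system if the latter
arises from the former by conditioning on the event that the information set is reached. -/
def Consistent {i : N} (b : G.BeliefSystem i) (β : G.normalForm.Belief i) : Prop :=
  ∀ I, DerivedByConditioning β (b.belief I) (G.oppReaching i I.1)

end ExtensiveGame

/-! The inclusion already holds for strategies: every strong level-`k` strategy is a level-`k`
action of the normal form (`strongLevel_subset_level`), so the same profile witnesses both outcomes.
The proof is by induction on the level. The key notion is an initial information set of `i`, one
before which `i` has not moved. A profile `t` of the others determines which of them is reached, if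
any; if none is, the strategy of `i` does not affect the outcome against `t`. Since nothing precedes
an initial information set, rationality there is optimality among all strategies. At level one, the
expected utility difference under the full-support prior is split over the initial information sets.
Each cell contributes a positive multiple of a difference of conditional expectations, which is
nonpositive; the remaining profiles contribute zero. At a higher level, take some `t` in the strong
sets of the previous level. If it reaches an initial information set, the belief there is certain of
those sets, and by induction it is a suitable normal-form belief. Otherwise the point mass at `t`
works, since everything is optimal against it. The existence of `t` requires the strong sets to be
nonempty (`strongLevel_nonempty`). Put the prior at index zero and a belief with support equal to
the level-`m` sets at index `m`; at each information set condition the belief of largest index that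
allows it. A strategy maximizing expected utility lexicographically, larger indices first, is
rational everywhere: a profitable deviation from an information set onwards would improve the first
objective that it affects. -/

theorem List.exists_cons_suffix_of_suffix_of_ne {α : Type*} {g h : List α} (hs : g <:+ h)
    (hne : g ≠ h) : ∃ a, a :: g <:+ h := by
  obtain ⟨l, rfl⟩ := hs
  rcases List.eq_nil_or_concat l with rfl | ⟨l', a, rfl⟩
  · simp at hne
  · exact ⟨a, l', by simp⟩

theorem List.ne_of_cons_suffix {α : Type*} {a : α} {g h : List α} (hs : a :: g <:+ h) :
    g ≠ h := by
  rintro rfl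
  simpa using hs.length_le

/-- A finite family of objectives, of which those with a larger index have priority, has a
lexicographic maximizer. -/
theorem exists_lex_max {X : Type*} (f : ℕ → X → ℝ) (k : ℕ) (s : Set X) (hs : s.Finite)
    (hne : s.Nonempty) :
    ∃ x ∈ s, ∀ y ∈ s, ∀ m < k, (∀ l, m < l → l < k → f l y = f l x) → f m y ≤ f m x := by
  induction k generalizing s with
  | zero =>
    obtain ⟨x, hx⟩ := hne
    exact ⟨x, hx, fun _ _ _ hm => absurd hm (Nat.not_lt_zero _)⟩
  | succ k ih =>
    obtain ⟨x₀, hx₀, hmax⟩ := hs.exists_maximalFor (f k) s hne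
    have hmax' : ∀ y ∈ s, f k y ≤ f k x₀ := fun y hy =>
      (le_total (f k y) (f k x₀)).elim id fun h => hmax hy h
    -- The objective of highest priority is maximized first; the others are handled by induction on
    -- the set of its maximizers.
    obtain ⟨x, ⟨hx, hxk⟩, hbest⟩ := ih {x ∈ s | f k x = f k x₀}
      (hs.subset (Set.sep_subset _ _)) ⟨x₀, hx₀, rfl⟩
    refine ⟨x, hx, fun y hy m hm heq => ?_⟩
    rcases Nat.lt_succ_iff_lt_or_eq.1 hm with h | rfl
    · exact hbest y ⟨hy, (heq k h k.lt_succ_self).trans hxk⟩ m h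
        fun l hl hlk => heq l hl (hlk.trans k.lt_succ_self)
    · exact (hmax' y hy).trans_eq hxk.symm

/-! ### Conditioning and expectations of finite beliefs -/

section Beliefs

theorem certainOf_iff {T : Type u} {p : PMF T} {E : Set T} : CertainOf p E ↔ p.support ⊆ E :=
  PMF.toOuterMeasure_apply_eq_one_iff p E

theorem PMF.exists_support_eq {T : Type u} [Finite T] {E : Set T} (hE : E.Nonempty) :
    ∃ p : PMF T, p.support = E := by
  classical
  refine ⟨PMF.uniformOfFinset E.toFinite.toFinset (by simpa using hE), ?_⟩
  simp

theorem PMF.filter_filter {T : Type u} (p : PMF T) {E F : Set T} (hFE : F ⊆ E)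
    (hE : ∃ t ∈ E, t ∈ p.support) (hF : ∃ t ∈ F, t ∈ p.support)
    (hF' : ∃ t ∈ F, t ∈ (p.filter E hE).support) :
    (p.filter E hE).filter F hF' = p.filter F hF := by
  -- On `F ⊆ E`, the first conditioning only rescales by a constant, which the second normalization
  -- cancels.
  have key : ∀ t, F.indicator (p.filter E hE) t =
      F.indicator p t * (∑' t', E.indicator p t')⁻¹ := by
    intro t
    by_cases ht : t ∈ F
    · simp [ht, hFE ht, PMF.filter_apply]
    · simp [ht]
  have h0 : (∑' t', E.indicator p t') ≠ 0 := by
    obtain ⟨t, ht, hp⟩ := hE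
    intro h
    have := ENNReal.tsum_eq_zero.1 h t
    simp only [Set.indicator_of_mem ht] at this
    exact hp this
  have htop : (∑' t', E.indicator p t') ≠ ⊤ := p.tsum_coe_indicator_ne_top E
  ext t
  rw [PMF.filter_apply, PMF.filter_apply]
  simp_rw [key]
  rw [ENNReal.tsum_mul_right, ENNReal.mul_inv (Or.inr (ENNReal.inv_ne_top.2 h0))
    (Or.inr (ENNReal.inv_ne_zero.2 htop)), inv_inv, mul_assoc,
    mul_comm (∑' t', E.indicator p t')⁻¹, mul_assoc, ENNReal.mul_inv_cancel h0 htop, mul_one]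

open Classical in
/-- Integrating over `E` amounts, up to a positive factor, to taking the expectation conditional
on `E`. -/
theorem exists_sum_eq_mul_expectation_filter {T : Type u} [Fintype T] (p : PMF T) (E : Set T)
    (h : ∃ t ∈ E, t ∈ p.support) :
    ∃ c : ℝ, 0 < c ∧ ∀ f : T → ℝ,
      ∑ t, (if t ∈ E then (p t).toReal * f t else 0) = c * expectation (p.filter E h) f := by
  have h0 : (∑' t', E.indicator p t') ≠ 0 := by
    obtain ⟨t, ht, hp⟩ := h
    intro h
    have := ENNReal.tsum_eq_zero.1 h t
    simp only [Set.indicator_of_mem ht] at this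
    exact hp this
  have htop : (∑' t', E.indicator p t') ≠ ⊤ := p.tsum_coe_indicator_ne_top E
  have hc := ENNReal.toReal_pos h0 htop
  refine ⟨_, hc, fun f => ?_⟩
  have hexp : expectation (p.filter E h) f = ∑ t, ((p.filter E h) t).toReal * f t :=
    tsum_fintype _
  rw [hexp, Finset.mul_sum]
  refine Finset.sum_congr rfl fun t _ => ?_
  rw [PMF.filter_apply, ENNReal.toReal_mul, ENNReal.toReal_inv]
  by_cases ht : t ∈ E
  · rw [if_pos ht, Set.indicator_of_mem ht]
    field_simp
  · rw [if_neg ht, Set.indicator_of_notMem ht]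
    simp

theorem certainOf_pure {T : Type u} {t : T} {E : Set T} (ht : t ∈ E) :
    CertainOf (PMF.pure t) E := by
  rwa [certainOf_iff, PMF.support_pure, Set.singleton_subset_iff]

theorem expectation_pure {T : Type u} (t : T) (f : T → ℝ) : expectation (PMF.pure t) f = f t := by
  rw [expectation, tsum_eq_single t]
  · simp
  · intro t' ht'
    simp [PMF.pure_apply_of_ne _ _ ht']

theorem expectation_sub {T : Type u} [Finite T] (p : PMF T) (f g : T → ℝ) :
    expectation p (fun t => f t - g t) = expectation p f - expectation p g := by
  have := Fintype.ofFinite T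
  simp [expectation, mul_sub]

end Beliefs

/-! ### Profiles and products -/

theorem joinProfile_self {N : Type u} {S : Option N → Type v} (i : N) (x : S (some i))
    (t : OppProfile S i) : joinProfile i x t (some i) = x := by
  simp [joinProfile]

theorem joinProfile_of_ne {N : Type u} {S : Option N → Type v} (i : N) (x : S (some i))
    (t : OppProfile S i) {j : Option N} (hj : j ≠ some i) :
    joinProfile i x t j = t ⟨j, hj⟩ := by
  simp [joinProfile, hj]

theorem oppSet_nonempty {N : Type u} {S : Option N → Type v} {L : (j : Option N) → Set (S j)}
    (hL : ∀ j, (L j).Nonempty) (i : N) : (oppSet L i).Nonempty :=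
  ⟨fun j => (hL j).some, fun j => (hL j).some_mem⟩

theorem oppSet_mono {N : Type u} {S : Option N → Type v} {L L' : (j : Option N) → Set (S j)}
    (hL : ∀ j, L j ⊆ L' j) (i : N) : oppSet L i ⊆ oppSet L' i :=
  fun _ ht j => hL j (ht j)

theorem NormalFormGame.rational_pure {N : Type u} {Γ : NormalFormGame.{u, v} N} {i : N}
    {x : Γ.Act (some i)} {t : OppProfile Γ.Act i}
    (h : ∀ y, Γ.util i (joinProfile i y t) = Γ.util i (joinProfile i x t)) :
    Γ.Rational i x (PMF.pure t) := by
  intro y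
  rw [expectedUtil, expectedUtil, expectation_pure, expectation_pure]
  exact (h y).le

namespace ExtensiveGame

variable {N : Type u} {A : Type v} (G : ExtensiveGame N A)

/-! ### Play -/

theorem mem_of_suffix {g h : History N A} (hs : g <:+ h) (hh : h ∈ G.H) : g ∈ G.H := by
  induction h with
  | nil => rwa [List.suffix_nil.1 hs]
  | cons a h ih =>
    rcases List.suffix_cons_iff.1 hs with rfl | hs
    · exact hh
    · exact ih hs (G.mem_of_cons_mem a h hh)

theorem nonterminalIn_of_cons_suffix {a : ActionProfile N A} {g h : History N A}
    (hs : a :: g <:+ h) (hh : h ∈ G.H) : NonterminalIn G.H g :=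
  have hg := G.mem_of_suffix hs hh
  ⟨G.mem_of_cons_mem a g hg, a, hg⟩

theorem cell_mem_infoSets_iff {g : History N A} (hg : NonterminalIn G.H g) {j : Option N} :
    G.cell j g ∈ G.infoSets j ↔ j ∈ G.P g := by
  constructor
  · intro hc
    obtain ⟨_, I, hI, hgI, -⟩ := G.infoSets_nonempty hc
    exact (G.infoSets_subset hI hgI).2
  · intro hP
    obtain ⟨I, hI, hgI⟩ := G.exists_infoSet hg hP
    rwa [G.cell_eq hI hgI]

theorem mem_cell_self {g : History N A} {j : Option N} (hc : G.cell j g ∈ G.infoSets j) :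
    g ∈ G.cell j g := by
  obtain ⟨_, I, hI, hgI, -⟩ := G.infoSets_nonempty hc
  exact ⟨I, hI, hgI, hgI⟩

theorem exists_eq_some_iff {a : ActionProfile N A} {g h : History N A} (hs : a :: g <:+ h)
    (hh : h ∈ G.H) {j : Option N} : (∃ x, a j = some x) ↔ G.cell j g ∈ G.infoSets j := by
  have hg := G.nonterminalIn_of_cons_suffix hs hh
  rw [G.cell_mem_infoSets_iff hg]
  have := (G.cons_mem_iff g hg a).1 (G.mem_of_suffix hs hh) j
  constructor
  · rintro ⟨x, hx⟩
    by_contra hP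
    simp [this.2 hP] at hx
  · intro hP
    obtain ⟨x, -, hx⟩ := this.1 hP
    exact ⟨x, hx⟩

open Classical in
/-- The move of `j` at the history `h` when playing the strategy `σ`, if `j` moves at `h`. -/
noncomputable def moveOf (j : Option N) (σ : G.Strategy j) (h : History N A) : Option A :=
  if hj : G.cell j h ∈ G.infoSets j then some (σ ⟨G.cell j h, hj⟩).1 else none

/-- All moves of `j` along the history `h` are those of the strategy `σ`. -/
def Follows (j : Option N) (σ : G.Strategy j) (h : History N A) : Prop :=
  ∀ a g, a :: g <:+ h → a j = G.moveOf j σ g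

theorem eq_prescribed_of_suffix_path (s : G.Profile) (n : ℕ) {a : ActionProfile N A}
    {g : History N A} (hs : a :: g <:+ G.path s n) : a = G.prescribed s g := by
  induction n with
  | zero => simp [path] at hs
  | succ n ih =>
    rw [path] at hs
    split_ifs at hs
    · rcases List.suffix_cons_iff.1 hs with h | h
      · obtain ⟨rfl, rfl⟩ := List.cons.inj h
        rfl
      · exact ih h
    · exact ih hs

/-- This replaces the recursion defining the play by a separate condition on each player's strategy,
so that own moves and opponents' moves can be recombined freely. -/
theorem suffix_outcome_iff (s : G.Profile) {h : History N A} (hh : h ∈ G.H) :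
    h <:+ (G.outcome s).1 ↔ ∀ j, G.Follows j (s j) h := by
  constructor
  · intro hs j a g hg
    exact congrFun (G.eq_prescribed_of_suffix_path s _ (hg.trans hs)) j
  · induction h with
    | nil => exact fun _ => List.nil_suffix
    | cons a h ih =>
      intro hf
      have hs := ih (G.mem_of_cons_mem a h hh) fun j b g hg =>
        hf j b g (hg.trans (List.suffix_cons a h))
      have hne : h ≠ (G.outcome s).1 := by
        rintro rfl
        exact (G.outcome s).2.2 ⟨a, hh⟩
      obtain ⟨b, hb⟩ := List.exists_cons_suffix_of_suffix_of_ne hs hne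
      have hba : b = a := by
        rw [G.eq_prescribed_of_suffix_path s _ hb]
        funext j
        exact (hf j a h List.suffix_rfl).symm
      rwa [← hba]

theorem outcome_eq_of_follows (s : G.Profile) (z : G.Terminal)
    (h : ∀ j, G.Follows j (s j) z.1) : G.outcome s = z := by
  have hs := (G.suffix_outcome_iff s z.2.1).2 h
  by_contra hne
  obtain ⟨a, ha⟩ := List.exists_cons_suffix_of_suffix_of_ne hs fun h => hne (Subtype.ext h.symm)
  exact z.2.2 ⟨a, G.mem_of_suffix ha (G.outcome s).2.1⟩

/-- All moves of the opponents of `i` along the history `h` are those of the profile `t`. -/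
def OppFollows (i : N) (t : G.Opp i) (h : History N A) : Prop :=
  ∀ j : {j : Option N // j ≠ some i}, G.Follows j (t j) h

theorem forall_follows_joinProfile_iff {i : N} {x : G.Strategy (some i)} {t : G.Opp i}
    {h : History N A} : (∀ j, G.Follows j (joinProfile i x t j) h) ↔
      G.Follows (some i) x h ∧ G.OppFollows i t h := by
  constructor
  · intro hf
    refine ⟨?_, fun j => ?_⟩
    · simpa only [joinProfile_self] using hf (some i)
    · simpa only [joinProfile_of_ne i x t j.2] using hf j
  · rintro ⟨hx, ht⟩ j
    by_cases hj : j = some i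
    · subst hj
      rwa [joinProfile_self]
    · rw [joinProfile_of_ne i x t hj]
      exact ht ⟨j, hj⟩

theorem suffix_outcome_joinProfile_iff {i : N} {x : G.Strategy (some i)} {t : G.Opp i}
    {h : History N A} (hh : h ∈ G.H) : h <:+ (G.outcome (joinProfile i x t)).1 ↔
      G.Follows (some i) x h ∧ G.OppFollows i t h := by
  rw [G.suffix_outcome_iff _ hh, G.forall_follows_joinProfile_iff]

/-- If `y` makes the same moves as `x` along the path of `x`, then it reaches the same terminal
history. -/
theorem outcome_joinProfile_congr {i : N} {x y : G.Strategy (some i)} {t : G.Opp i}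
    (h : ∀ a g, a :: g <:+ (G.outcome (joinProfile i x t)).1 →
      ∀ hg : G.cell (some i) g ∈ G.info i, y ⟨_, hg⟩ = x ⟨_, hg⟩) :
    G.outcome (joinProfile i y t) = G.outcome (joinProfile i x t) := by
  have hz := (G.suffix_outcome_joinProfile_iff (G.outcome (joinProfile i x t)).2.1).1
    List.suffix_rfl
  refine G.outcome_eq_of_follows _ _ (G.forall_follows_joinProfile_iff.2 ⟨?_, hz.2⟩)
  intro a g hg
  rw [hz.1 a g hg, moveOf, moveOf]
  split_ifs with hc
  · rw [h a g hg hc]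
  · rfl

/-! ### Experience and perfect recall -/

theorem mem_experience_iff {i : N} {h : History N A} {I : Set (History N A)} {x : A} :
    (I, x) ∈ G.experience i h ↔
      ∃ a g, a :: g <:+ h ∧ a (some i) = some x ∧ G.cell (some i) g = I := by
  induction h with
  | nil => simp [experience]
  | cons b h ih =>
    have hstep : (∃ a g, a :: g <:+ b :: h ∧ a (some i) = some x ∧ G.cell (some i) g = I) ↔
        (b (some i) = some x ∧ G.cell (some i) h = I) ∨
          ∃ a g, a :: g <:+ h ∧ a (some i) = some x ∧ G.cell (some i) g = I := by
      constructor
      · rintro ⟨a, g, hs, ha, hc⟩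
        rcases List.suffix_cons_iff.1 hs with hs | hs
        · obtain ⟨rfl, rfl⟩ := List.cons.inj hs
          exact Or.inl ⟨ha, hc⟩
        · exact Or.inr ⟨a, g, hs, ha, hc⟩
      · rintro (⟨ha, hc⟩ | ⟨a, g, hs, ha, hc⟩)
        · exact ⟨b, h, List.suffix_rfl, ha, hc⟩
        · exact ⟨a, g, hs.trans (List.suffix_cons b h), ha, hc⟩
    rw [hstep, ← ih, experience]
    cases hb : b (some i) with
    | none => simp
    | some y =>
      simp only [List.mem_cons, Prod.mk.injEq, Option.some.injEq]
      tauto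

/-- Compatibility of a strategy with a history depends only on the player's own experience; this is
how perfect recall enters. -/
theorem follows_iff_experience {i : N} {x : G.Strategy (some i)} {h : History N A}
    (hh : h ∈ G.H) : G.Follows (some i) x h ↔
      ∀ p ∈ G.experience i h, ∃ hp : p.1 ∈ G.info i, (x ⟨p.1, hp⟩).1 = p.2 := by
  constructor
  · rintro hf ⟨I, y⟩ hp
    obtain ⟨a, g, hs, ha, rfl⟩ := G.mem_experience_iff.1 hp
    have hc := (G.exists_eq_some_iff hs hh).1 ⟨y, ha⟩
    refine ⟨hc, ?_⟩
    have := hf a g hs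
    rw [ha, moveOf, dif_pos hc] at this
    exact (Option.some.inj this).symm
  · intro he a g hs
    rw [moveOf]
    split_ifs with hc
    · obtain ⟨y, hy⟩ := (G.exists_eq_some_iff hs hh).2 hc
      obtain ⟨_, hp⟩ := he _ (G.mem_experience_iff.2 ⟨a, g, hs, hy, rfl⟩)
      rw [hy, hp]
    · by_contra hne
      obtain ⟨y, hy⟩ := Option.ne_none_iff_exists'.1 hne
      exact hc ((G.exists_eq_some_iff hs hh).1 ⟨y, hy⟩)

variable {G} in
theorem PerfectRecall.follows_iff (hG : G.PerfectRecall) {i : N} {x : G.Strategy (some i)}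
    {I : Set (History N A)} (hI : I ∈ G.info i) {h h' : History N A} (hh : h ∈ I) (hh' : h' ∈ I) :
    G.Follows (some i) x h ↔ G.Follows (some i) x h' := by
  rw [G.follows_iff_experience (G.info_subset i I hI h hh).1.1,
    G.follows_iff_experience (G.info_subset i I hI h' hh').1.1, hG i I hI h hh h' hh']

variable {G} in
/-- If `I` precedes `J`, then it is passed on the way to any history in `J`. -/
theorem PerfectRecall.exists_suffix_of_precedes (hG : G.PerfectRecall) {i : N}
    {I J : Set (History N A)} (hI : I ∈ G.info i) (hJ : J ∈ G.info i) (hIJ : Precedes I J)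
    {h : History N A} (hh : h ∈ J) : ∃ g ∈ I, g <:+ h := by
  obtain ⟨g, hg, g', hg', hs, hne⟩ := hIJ
  have hg'H := (G.info_subset i J hJ g' hg').1.1
  obtain ⟨a, ha⟩ := List.exists_cons_suffix_of_suffix_of_ne hs hne
  have hcell : G.cell (some i) g = I := G.cell_eq (j := some i) hI hg
  -- The move at `g` is recorded in the experience of `g'`, which perfect recall makes the
  -- experience of `h` as well.
  obtain ⟨x, hx⟩ := (G.exists_eq_some_iff (j := some i) ha hg'H).2 (by rw [hcell]; exact hI)
  have hmem : (I, x) ∈ G.experience i h := by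
    rw [hG i J hJ h hh g' hg']
    exact G.mem_experience_iff.2 ⟨a, g, ha, hx, hcell⟩
  obtain ⟨b, f, hf, -, hc⟩ := G.mem_experience_iff.1 hmem
  refine ⟨f, ?_, (List.suffix_cons b f).trans hf⟩
  rw [← hc]
  exact G.mem_cell_self (j := some i) (by rw [hc]; exact hI)

theorem mem_oppReaching_iff {i : N} {I : Set (History N A)} (hI : I ∈ G.info i) {t : G.Opp i} :
    t ∈ G.oppReaching i I ↔
      ∃ x : G.Strategy (some i), ∃ h ∈ I, G.Follows (some i) x h ∧ G.OppFollows i t h := by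
  refine exists_congr fun x => exists_congr fun h => and_congr_right fun hh => ?_
  exact G.suffix_outcome_joinProfile_iff (G.info_subset i I hI h hh).1.1

theorem Follows.of_suffix {G : ExtensiveGame N A} {j : Option N} {σ : G.Strategy j}
    {g h : History N A} (hf : G.Follows j σ h) (hs : g <:+ h) : G.Follows j σ g :=
  fun a f ha => hf a f (ha.trans hs)

variable {G} in
theorem PerfectRecall.oppReaching_anti (hG : G.PerfectRecall) {i : N}
    {I J : Set (History N A)} (hI : I ∈ G.info i) (hJ : J ∈ G.info i) (hIJ : Precedes I J) :
    G.oppReaching i J ⊆ G.oppReaching i I := by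
  intro t ht
  obtain ⟨x, h, hh, hx, ht⟩ := (G.mem_oppReaching_iff hJ).1 ht
  obtain ⟨g, hg, hs⟩ := hG.exists_suffix_of_precedes hI hJ hIJ hh
  exact (G.mem_oppReaching_iff hI).2 ⟨x, g, hg, hx.of_suffix hs, fun j => (ht j).of_suffix hs⟩

/-- Reaching one history of `I` suffices: perfect recall transfers compatibility to every other
history of `I`, whichever one the opponents lead to. -/
theorem follows_of_ownReaches {G : ExtensiveGame N A} (hG : G.PerfectRecall) {i : N}
    {I : Set (History N A)} (hI : I ∈ G.info i) {x : G.Strategy (some i)}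
    (hx : G.OwnReaches i x I) {h : History N A} (hh : h ∈ I) : G.Follows (some i) x h := by
  obtain ⟨t, g, hg, hs⟩ := hx
  have := (G.suffix_outcome_joinProfile_iff (G.info_subset i I hI g hg).1.1).1 hs
  exact (hG.follows_iff hI hg hh).1 this.1

/-! ### Deviating from an information set onwards -/

open Classical in
/-- The strategy that coincides with `y` at `I` and after `I`, and with `x` elsewhere. -/
noncomputable def deviateFrom {i : N} (I : Set (History N A)) (x y : G.Strategy (some i)) :
    G.Strategy (some i) :=
  fun J => if J.1 = I ∨ Precedes I J.1 then y J else x J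

-- The opponents in `t` lead to some `h ∈ I`, and both `x` and `y` follow `h`. Along the play of
-- `y`, the two strategies agree before `h`, and the deviation prescribes `y` from `h` on.
variable {G} in
theorem PerfectRecall.outcome_deviateFrom_of_mem (hG : G.PerfectRecall) {i : N}
    {I : Set (History N A)} (hI : I ∈ G.info i) {x y : G.Strategy (some i)}
    (hx : G.OwnReaches i x I) (hxy : G.IsReplacement i I x y) {t : G.Opp i}
    (ht : t ∈ G.oppReaching i I) :
    G.outcome (joinProfile i (G.deviateFrom I x y) t) = G.outcome (joinProfile i y t) := by
  obtain ⟨-, h, hh, -, ht⟩ := (G.mem_oppReaching_iff hI).1 ht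
  have hhH := (G.info_subset i I hI h hh).1.1
  have hfx := follows_of_ownReaches hG hI hx hh
  have hprec : ∀ {g}, g <:+ h → g ≠ h → ∀ hg : G.cell (some i) g ∈ G.info i,
      y ⟨_, hg⟩ = x ⟨_, hg⟩ := fun {g} hs hne hg =>
    hxy ⟨_, hg⟩ ⟨g, G.mem_cell_self (j := some i) hg, h, hh, hs, hne⟩
  have hfy : G.Follows (some i) y h := by
    intro a g hs
    rw [hfx a g hs, moveOf, moveOf]
    split_ifs with hc
    · rw [hprec ((List.suffix_cons a g).trans hs) (List.ne_of_cons_suffix hs) hc]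
    · rfl
  have hhz := (G.suffix_outcome_joinProfile_iff hhH).2 ⟨hfy, ht⟩
  refine G.outcome_joinProfile_congr fun a g hs hg => ?_
  have hgz := (List.suffix_cons a g).trans hs
  rw [deviateFrom]
  split_ifs with hc
  · rfl
  · rw [not_or] at hc
    have hne : g ≠ h := by
      rintro rfl
      exact hc.1 (G.cell_eq (j := some i) hI hh)
    -- Both `g` and `h` lie on the play of `y`, so one is an initial segment of the other.
    rcases List.suffix_or_suffix_of_suffix hgz hhz with hgh | hhg
    · exact (hprec hgh hne hg).symm
    · exact absurd ⟨h, hh, g, G.mem_cell_self (j := some i) hg, hhg, hne.symm⟩ hc.2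

-- If the play of `x` met an information set at which the deviation uses `y`, then by perfect recall
-- it would have passed through `I`.
variable {G} in
theorem PerfectRecall.outcome_deviateFrom_of_notMem (hG : G.PerfectRecall) {i : N}
    {I : Set (History N A)} (hI : I ∈ G.info i) (x y : G.Strategy (some i)) {t : G.Opp i}
    (ht : t ∉ G.oppReaching i I) :
    G.outcome (joinProfile i (G.deviateFrom I x y) t) = G.outcome (joinProfile i x t) := by
  refine G.outcome_joinProfile_congr fun a g hs hg => ?_
  have hgz := (List.suffix_cons a g).trans hs
  have hgg := G.mem_cell_self (j := some i) hg
  rw [deviateFrom, if_neg]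
  rintro (hc | hc)
  · exact ht ⟨x, g, hc ▸ hgg, hgz⟩
  · obtain ⟨f, hf, hfg⟩ := hG.exists_suffix_of_precedes hI hg hc hgg
    exact ht ⟨x, f, hf, hfg.trans hgz⟩

instance finite_opp [Finite N] (i : N) : Finite (G.Opp i) :=
  inferInstanceAs (Finite ((j : {j : Option N // j ≠ some i}) → G.Strategy j))

-- The deviation matters only against opponents reaching `I`. Hence a gain at `I` changes the
-- objective of any unconditional belief exactly by its part on that event.
open Classical in
variable {G} in
theorem PerfectRecall.expectedUtil_deviateFrom_sub (hG : G.PerfectRecall) {i : N}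
    [Fintype (G.Opp i)]
    {I : Set (History N A)} (hI : I ∈ G.info i) {x y : G.Strategy (some i)}
    (hx : G.OwnReaches i x I) (hxy : G.IsReplacement i I x y) (p : PMF (G.Opp i)) :
    G.expectedUtil i (G.deviateFrom I x y) p - G.expectedUtil i x p =
      ∑ t, if t ∈ G.oppReaching i I then
        (p t).toReal * (G.util i (G.outcome (joinProfile i y t)) -
          G.util i (G.outcome (joinProfile i x t))) else 0 := by
  rw [expectedUtil, expectedUtil, expectation, expectation, tsum_fintype, tsum_fintype,
    ← Finset.sum_sub_distrib]
  refine Finset.sum_congr rfl fun t _ => ?_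
  split_ifs with ht
  · rw [hG.outcome_deviateFrom_of_mem hI hx hxy ht, mul_sub]
  · rw [hG.outcome_deviateFrom_of_notMem hI x y ht, sub_self]

/-! ### Existence of rational strategies -/

variable {G} in
/-- A sequence of beliefs, of which those with a larger index have priority, gives rise to a
belief system, and some strategy is rational at every information set with it. -/
theorem PerfectRecall.exists_belief_rational [Finite N] (hG : G.PerfectRecall) {i : N}
    (μ : ℕ → PMF (G.Opp i)) (k : ℕ)
    (top : {I // I ∈ G.info i} → ℕ)
    (htop : ∀ I, IsGreatest {m | m < k ∧ ∃ t ∈ G.oppReaching i I.1, t ∈ (μ m).support} (top I)) :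
    ∃ b : G.BeliefSystem i,
      (∀ I, b.belief I = (μ (top I)).filter (G.oppReaching i I.1) (htop I).1.2) ∧
      ∃ x, ∀ I, G.RationalAt i x b I := by
  classical
  have := Fintype.ofFinite (G.Opp i)
  let b : G.BeliefSystem i :=
    { belief := fun I => (μ (top I)).filter (G.oppReaching i I.1) (htop I).1.2
      reaches := fun I => by
        rw [certainOf_iff, PMF.support_filter]
        exact Set.inter_subset_left
      conditioning := fun I J hIJ h => by
        have hsub := hG.oppReaching_anti I.2 J.2 hIJ
        obtain ⟨t, htJ, ht⟩ := id h
        rw [PMF.support_filter] at ht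
        -- Profiles reaching `J` also reach `I`, which gives one inequality. Conversely, positive
        -- conditional probability of `J` at `I` makes `top I` a candidate at `J`.
        have heq : top J = top I := le_antisymm
          ((htop I).2 ⟨(htop J).1.1, (htop J).1.2.imp fun t ht => ⟨hsub ht.1, ht.2⟩⟩)
          ((htop J).2 ⟨(htop I).1.1, t, htJ, ht.2⟩)
        rw [PMF.filter_filter _ hsub _ ⟨t, htJ, ht.2⟩]
        simp only [heq] }
  refine ⟨b, fun I => rfl, ?_⟩
  obtain ⟨x, -, hx⟩ := exists_lex_max (fun m x => G.expectedUtil i x (μ m)) k Set.univ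
    (Set.toFinite (Set.univ : Set (G.Strategy (some i)))) Set.univ_nonempty
  refine ⟨x, fun I => or_iff_not_imp_left.2 fun hr => ?_⟩
  rw [not_not] at hr
  rintro ⟨y, hxy, hlt⟩
  have hdiff := hG.expectedUtil_deviateFrom_sub I.2 hr hxy
  -- Beliefs with index above `top I` vanish on the profiles reaching `I`, so the deviation ties on
  -- all objectives of higher priority.
  have hle := hx (G.deviateFrom I.1 x y) (Set.mem_univ _) (top I) (htop I).1.1 fun l hl hlk => by
    refine sub_eq_zero.1 ((hdiff (μ l)).trans (Finset.sum_eq_zero fun t _ => ?_))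
    split_ifs with ht
    · have : μ l t = 0 := by
        by_contra hne
        exact absurd ((htop I).2 ⟨hlk, t, ht, hne⟩) (not_le.2 hl)
      simp [this]
    · rfl
  obtain ⟨c, hc, hsum⟩ := exists_sum_eq_mul_expectation_filter (μ (top I)) _ (htop I).1.2
  have h1 := hdiff (μ (top I))
  rw [hsum, expectation_sub] at h1
  have h2 : 0 < expectation (b.belief I) (fun t => G.util i (G.outcome (joinProfile i y t))) -
      expectation (b.belief I) (fun t => G.util i (G.outcome (joinProfile i x t))) :=
    sub_pos.2 hlt
  have h3 := mul_pos hc h2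
  exact absurd (h3.trans_eq h1.symm) (not_lt.2 (sub_nonpos.2 hle))

theorem strongLevel_some (b₁ : (i : N) → G.BeliefSystem i) (k : ℕ) (i : N) :
    G.strongLevel b₁ k (some i) =
      {x | ∃ b ∈ G.strongBeliefs i (b₁ i) k (fun ℓ _ j => G.strongLevel b₁ ℓ j),
        ∀ I, G.RationalAt i x b I} := by
  rw [strongLevel]

theorem strongLevel_none (b₁ : (i : N) → G.BeliefSystem i) (k : ℕ) :
    G.strongLevel b₁ k none = Set.univ := by
  rw [strongLevel]

-- By strong induction on the level, the earlier sets carry beliefs of exact support. Exactness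
-- makes the largest index compatible with an information set the highest level that reaches it, and
-- the full-support prior guarantees that some index is always compatible.
variable {G} in
theorem PerfectRecall.strongLevel_nonempty [Finite N] (hG : G.PerfectRecall)
    {b₁ : (i : N) → G.BeliefSystem i} (hb₁ : ∀ i, (b₁ i).FullSupport)
    {β₁ : (i : N) → G.normalForm.Belief i} (hβ₁ : ∀ i, (β₁ i).support = Set.univ)
    (hcons : ∀ i, G.Consistent (b₁ i) (β₁ i)) (k : ℕ) (hk : 1 ≤ k) (j : Option N) :
    (G.strongLevel b₁ k j).Nonempty := by
  classical
  induction k using Nat.strong_induction_on generalizing j with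
  | _ k ih =>
  cases j with
  | none =>
    rw [strongLevel_none]
    exact Set.univ_nonempty
  | some i =>
  -- Index `0` holds the prior; the value at indices `m ≥ k` is arbitrary, since only indices below
  -- `k` compete.
  have hμ : ∀ m, ∃ p : PMF (G.Opp i), (m = 0 → p = β₁ i) ∧
      (1 ≤ m → m < k → p.support = oppSet (fun j => G.strongLevel b₁ m j) i) := by
    intro m
    by_cases hm : 1 ≤ m ∧ m < k
    · obtain ⟨p, hp⟩ := PMF.exists_support_eq (oppSet_nonempty (fun j => ih m hm.2 hm.1 j) i)
      exact ⟨p, fun h => by omega, fun _ _ => hp⟩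
    · exact ⟨β₁ i, fun _ => rfl, fun h h' => absurd ⟨h, h'⟩ hm⟩
  choose μ hμ0 hμ1 using hμ
  have hne : ∀ I : {I // I ∈ G.info i}, ∃ t ∈ G.oppReaching i I.1, t ∈ (μ 0).support := by
    intro I
    obtain ⟨t, ht⟩ := ((b₁ i).belief I).support_nonempty
    refine ⟨t, hb₁ i I ▸ ht, ?_⟩
    rw [hμ0 0 rfl]
    exact (hβ₁ i).symm ▸ Set.mem_univ t
  have htop : ∀ I : {I // I ∈ G.info i},
      ∃ m, IsGreatest {m | m < k ∧ ∃ t ∈ G.oppReaching i I.1, t ∈ (μ m).support} m := by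
    intro I
    obtain ⟨m, hm, hmax⟩ := Set.exists_max_image
      {m | m < k ∧ ∃ t ∈ G.oppReaching i I.1, t ∈ (μ m).support} id
      ((Set.finite_lt_nat k).subset fun m hm => hm.1) ⟨0, hk, hne I⟩
    exact ⟨m, hm, fun l hl => hmax l hl⟩
  choose top htop using htop
  obtain ⟨b, hb, x, hx⟩ := hG.exists_belief_rational μ k top htop
  rw [strongLevel_some]
  refine ⟨x, b, fun I => ⟨fun ℓ hℓ hgr => ?_, fun hno => ?_⟩, hx⟩
  · have heq : top I = ℓ := by
      refine (htop I).unique ⟨⟨hℓ, ?_⟩, fun m hm => ?_⟩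
      · obtain ⟨_, _, t, ht, htr⟩ := hgr.1
        exact ⟨t, htr, (hμ1 ℓ hgr.1.1 hℓ).symm ▸ ht⟩
      · rcases Nat.eq_zero_or_pos m with rfl | hpos
        · exact Nat.zero_le _
        · obtain ⟨hmk, t, htr, ht⟩ := hm
          rw [hμ1 m hpos hmk] at ht
          exact hgr.2 ⟨hpos, hmk, t, ht, htr⟩
    rw [certainOf_iff, hb I, PMF.support_filter, heq, hμ1 ℓ hgr.1.1 hℓ]
    exact Set.inter_subset_right
  -- With no level reaching `I`, only the prior remains, and consistency identifies its conditional
  -- with the first-level belief.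
  · have heq : top I = 0 := by
      by_contra hne0
      obtain ⟨hmk, t, htr, ht⟩ := (htop I).1
      have hpos : 1 ≤ top I := Nat.one_le_iff_ne_zero.2 hne0
      rw [hμ1 _ hpos hmk] at ht
      exact hno ⟨top I, hpos, hmk, t, ht, htr⟩
    have h0 := (htop I).1.2
    rw [heq, hμ0 0 rfl] at h0
    rw [hb I, hcons i I h0]
    simp only [heq, hμ0 0 rfl]
    rfl

/-! ### Initial information sets -/

/-- An information set of `i` before which `i` does not move. -/
def IsInitial (i : N) (I : Set (History N A)) : Prop :=
  I ∈ G.info i ∧ ∀ h ∈ I, G.experience i h = []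

theorem experience_ne_nil {i : N} {h : History N A} {a : ActionProfile N A} {g : History N A}
    (hs : a :: g <:+ h) {x : A} (ha : a (some i) = some x) : G.experience i h ≠ [] :=
  List.ne_nil_of_mem (G.mem_experience_iff.2 ⟨a, g, hs, ha, rfl⟩)

theorem experience_ne_nil_of_mem_info {i : N} {I : Set (History N A)} (hI : I ∈ G.info i)
    {g h : History N A} (hg : g ∈ I) (hs : g <:+ h) (hne : g ≠ h) (hh : h ∈ G.H) :
    G.experience i h ≠ [] := by
  obtain ⟨a, ha⟩ := List.exists_cons_suffix_of_suffix_of_ne hs hne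
  obtain ⟨x, hx⟩ := (G.exists_eq_some_iff (j := some i) ha hh).2
    (by rw [G.cell_eq (j := some i) hI hg]; exact hI)
  exact G.experience_ne_nil ha hx

theorem follows_of_experience_eq_nil {i : N} {h : History N A} (hh : h ∈ G.H)
    (he : G.experience i h = []) (x : G.Strategy (some i)) : G.Follows (some i) x h := by
  rw [G.follows_iff_experience hh, he]
  simp

theorem exists_first_move {i : N} {h : History N A} (he : G.experience i h ≠ []) :
    ∃ a g, a :: g <:+ h ∧ (∃ x, a (some i) = some x) ∧ G.experience i g = [] := by
  induction h with
  | nil => simp [experience] at he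
  | cons a h ih =>
    by_cases hh : G.experience i h = []
    · refine ⟨a, h, List.suffix_rfl, ?_, hh⟩
      cases ha : a (some i) with
      | none => simp [experience, ha, hh] at he
      | some x => exact ⟨x, rfl⟩
    · obtain ⟨b, g, hs, hb, hg⟩ := ih hh
      exact ⟨b, g, hs.trans (List.suffix_cons a h), hb, hg⟩

variable {G} in
/-- Given the strategies of the others, either some initial information set of `i` is reached, or
the strategy of `i` is irrelevant. -/
theorem PerfectRecall.exists_isInitial_or (hG : G.PerfectRecall) {i : N} (t : G.Opp i) :
    (∃ I, G.IsInitial i I ∧ t ∈ G.oppReaching i I) ∨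
      ∀ x y, G.outcome (joinProfile i y t) = G.outcome (joinProfile i x t) := by
  by_cases h : ∃ x, G.experience i (G.outcome (joinProfile i x t)).1 ≠ []
  · left
    obtain ⟨x, hx⟩ := h
    have hz := (G.outcome (joinProfile i x t)).2.1
    obtain ⟨a, g, hs, ha, hg⟩ := G.exists_first_move hx
    have hc : G.cell (some i) g ∈ G.info i := (G.exists_eq_some_iff hs hz).1 ha
    have hgg := G.mem_cell_self (j := some i) hc
    exact ⟨G.cell (some i) g, ⟨hc, fun h hh => (hG i _ hc h hh g hgg).trans hg⟩, x, g, hgg,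
      (List.suffix_cons a g).trans hs⟩
  · right
    push Not at h
    intro x y
    have hz := (G.outcome (joinProfile i x t)).2.1
    refine G.outcome_eq_of_follows _ _ (G.forall_follows_joinProfile_iff.2 ⟨?_, ?_⟩)
    · exact G.follows_of_experience_eq_nil hz (h x) y
    · exact ((G.suffix_outcome_joinProfile_iff hz).1 List.suffix_rfl).2

theorem IsInitial.eq_of_mem_oppReaching {G : ExtensiveGame N A} {i : N}
    {I J : Set (History N A)} (hI : G.IsInitial i I) (hJ : G.IsInitial i J) {t : G.Opp i}
    (htI : t ∈ G.oppReaching i I) (htJ : t ∈ G.oppReaching i J) : I = J := by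
  obtain ⟨x, h, hh, -, ht⟩ := (G.mem_oppReaching_iff hI.1).1 htI
  obtain ⟨-, h', hh', -, ht'⟩ := (G.mem_oppReaching_iff hJ.1).1 htJ
  have hH := (G.info_subset i I hI.1 h hh).1.1
  have hH' := (G.info_subset i J hJ.1 h' hh').1.1
  have hs := (G.suffix_outcome_joinProfile_iff hH).2
    ⟨G.follows_of_experience_eq_nil hH (hI.2 h hh) x, ht⟩
  have hs' := (G.suffix_outcome_joinProfile_iff hH').2
    ⟨G.follows_of_experience_eq_nil hH' (hJ.2 h' hh') x, ht'⟩
  -- Both histories lie on the play of `x` against `t`. If one properly extended the other, `i`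
  -- would already have moved before it.
  have heq : h = h' := by
    by_contra hne
    rcases List.suffix_or_suffix_of_suffix hs hs' with hc | hc
    · exact G.experience_ne_nil_of_mem_info hI.1 hh hc hne hH' (hJ.2 h' hh')
    · exact G.experience_ne_nil_of_mem_info hJ.1 hh' hc (Ne.symm hne) hH (hI.2 h hh)
  subst heq
  rw [← G.cell_eq (j := some i) hI.1 hh, ← G.cell_eq (j := some i) hJ.1 hh']

/-- Rationality at an initial information set that can be reached is unconstrained optimality. -/
theorem IsInitial.expectedUtil_le {G : ExtensiveGame N A} {i : N}
    {I : Set (History N A)} (hI : G.IsInitial i I) {t : G.Opp i} (ht : t ∈ G.oppReaching i I)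
    {x : G.Strategy (some i)} {b : G.BeliefSystem i} (hx : G.RationalAt i x b ⟨I, hI.1⟩)
    (y : G.Strategy (some i)) :
    G.expectedUtil i y (b.belief ⟨I, hI.1⟩) ≤ G.expectedUtil i x (b.belief ⟨I, hI.1⟩) := by
  obtain ⟨-, h, hh, -, ht⟩ := (G.mem_oppReaching_iff hI.1).1 ht
  have hH := (G.info_subset i I hI.1 h hh).1.1
  have hr : G.OwnReaches i x I := ⟨t, h, hh, (G.suffix_outcome_joinProfile_iff hH).2
    ⟨G.follows_of_experience_eq_nil hH (hI.2 h hh) x, ht⟩⟩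
  refine not_lt.1 fun hlt => (hx.resolve_left (not_not_intro hr)) ⟨y, fun J hJ => ?_, hlt⟩
  obtain ⟨g, hg, g', hg', hs, hne⟩ := hJ
  exact absurd (hI.2 g' hg') (G.experience_ne_nil_of_mem_info J.2 hg hs hne
    (G.info_subset i I hI.1 g' hg').1.1)

/-! ### Strong level-`k` thinking implies level-`k` thinking -/

variable {G} in
/-- A strategy that is rational at all information sets with a belief system derived from a
full-support belief `β` maximizes the expected utility under `β`. -/
theorem PerfectRecall.expectedUtil_le_of_consistent [Finite N] (hG : G.PerfectRecall) {i : N}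
    {b : G.BeliefSystem i} {β : PMF (G.Opp i)} (hβ : β.support = Set.univ)
    (hcons : G.Consistent b β) {x : G.Strategy (some i)} (hx : ∀ I, G.RationalAt i x b I)
    (y : G.Strategy (some i)) : G.expectedUtil i y β ≤ G.expectedUtil i x β := by
  classical
  have := Fintype.ofFinite (G.Opp i)
  let f : G.Opp i → ℝ := fun t => (β t).toReal * (G.util i (G.outcome (joinProfile i y t)) -
    G.util i (G.outcome (joinProfile i x t)))
  -- The label of `t` is the initial information set it reaches; `∅`, which is never an information
  -- set, marks the profiles that reach none.
  let c : G.Opp i → Set (History N A) := fun t =>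
    if h : ∃ I, G.IsInitial i I ∧ t ∈ G.oppReaching i I then h.choose else ∅
  have hc : ∀ {I t}, G.IsInitial i I → t ∈ G.oppReaching i I → c t = I := by
    intro I t hI ht
    have h : ∃ I, G.IsInitial i I ∧ t ∈ G.oppReaching i I := ⟨I, hI, ht⟩
    simp only [c, dif_pos h]
    exact h.choose_spec.1.eq_of_mem_oppReaching hI h.choose_spec.2 ht
  have hf : ∑ t, f t ≤ 0 := by
    rw [← Finset.sum_fiberwise_of_maps_to (t := Finset.univ.image c)
      (fun t _ => Finset.mem_image_of_mem c (Finset.mem_univ t))]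
    refine Finset.sum_nonpos fun I _ => ?_
    by_cases h : ∃ t, G.IsInitial i I ∧ t ∈ G.oppReaching i I
    · obtain ⟨t₀, hI, ht₀⟩ := h
      have hpos : ∃ t ∈ G.oppReaching i I, t ∈ β.support := ⟨t₀, ht₀, hβ ▸ Set.mem_univ t₀⟩
      obtain ⟨r, hr, hsum⟩ := exists_sum_eq_mul_expectation_filter β _ hpos
      have hIle := hI.expectedUtil_le ht₀ (hx ⟨I, hI.1⟩) y
      rw [hcons ⟨I, hI.1⟩ hpos] at hIle
      -- The fibre of `c` over an initial information set is precisely the event that the opponents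
      -- reach it.
      have heq : ∑ t with c t = I, f t = ∑ t, if t ∈ G.oppReaching i I then f t else 0 := by
        rw [← Finset.sum_filter]
        refine Finset.sum_congr (Finset.filter_congr fun t _ => ⟨fun hct => ?_, hc hI⟩)
          fun _ _ => rfl
        by_cases h : ∃ J, G.IsInitial i J ∧ t ∈ G.oppReaching i J
        · obtain ⟨J, hJ, htJ⟩ := h
          rwa [← hct, hc hJ htJ]
        · simp only [c, dif_neg h] at hct
          exact absurd (G.info_nonempty i I hI.1) (by simp [← hct])
      rw [heq, hsum, expectation_sub]
      exact mul_nonpos_of_nonneg_of_nonpos hr.le (sub_nonpos.2 hIle)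
    · refine (Finset.sum_eq_zero fun t ht => ?_).le
      rcases hG.exists_isInitial_or t with ⟨J, hJ, htJ⟩ | hirr
      · have : J = I := (hc hJ htJ).symm.trans (Finset.mem_filter.1 ht).2
        exact absurd ⟨t, this ▸ hJ, this ▸ htJ⟩ h
      · simp only [f, hirr x y, sub_self, mul_zero]
  have hd : ∑ t, f t = G.expectedUtil i y β - G.expectedUtil i x β := by
    rw [expectedUtil, expectedUtil, ← expectation_sub, expectation, tsum_fintype]
  exact sub_nonpos.1 (hd ▸ hf)

-- The base case needs optimality under the given prior, hence rationality at all initial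
-- information sets. The inductive step may choose its belief, so one initial information set
-- reached by previous-level opponents suffices.
variable {G} in
theorem PerfectRecall.strongLevel_subset_level [Finite N] (hG : G.PerfectRecall)
    {b₁ : (i : N) → G.BeliefSystem i} (hb₁ : ∀ i, (b₁ i).FullSupport)
    {β₁ : (i : N) → G.normalForm.Belief i} (hβ₁ : ∀ i, (β₁ i).support = Set.univ)
    (hcons : ∀ i, G.Consistent (b₁ i) (β₁ i)) (k : ℕ) (j : Option N) :
    G.strongLevel b₁ (k + 1) j ⊆ G.normalForm.level β₁ (k + 1) j := by
  induction k generalizing j with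
  | zero =>
    cases j with
    | none =>
      rw [NormalFormGame.level]
      exact Set.subset_univ _
    | some i =>
      intro x hx
      rw [strongLevel_some] at hx
      obtain ⟨b, hb, hx⟩ := hx
      have hbb : ∀ I, b.belief I = (b₁ i).belief I := fun I => (hb I).2 (by
        rintro ⟨m, h1, h2, -⟩
        omega)
      have hcb : G.Consistent b (β₁ i) := fun I h => (hbb I).trans (hcons i I h)
      rw [NormalFormGame.level]
      exact hG.expectedUtil_le_of_consistent (hβ₁ i) hcb hx
  | succ k ih =>
    cases j with
    | none =>
      rw [NormalFormGame.level]
      exact Set.subset_univ _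
    | some i =>
      intro x hx
      rw [strongLevel_some] at hx
      obtain ⟨b, hb, hx⟩ := hx
      obtain ⟨t, ht⟩ := oppSet_nonempty
        (fun j => hG.strongLevel_nonempty hb₁ hβ₁ hcons (k + 1) (by omega) j) i
      rw [NormalFormGame.level]
      rcases hG.exists_isInitial_or t with ⟨I, hI, htI⟩ | hirr
      · refine ⟨b.belief ⟨I, hI.1⟩, ?_, hI.expectedUtil_le htI (hx _)⟩
        -- As `t` has level `k + 1`, the largest level below `k + 2`, no lower level is used at `I`.
        have hcert := (hb ⟨I, hI.1⟩).1 (k + 1) (by omega)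
          ⟨⟨by omega, by omega, t, ht, htI⟩, fun m ⟨_, hm, _⟩ => by omega⟩
        exact certainOf_iff.2 ((certainOf_iff.1 hcert).trans (oppSet_mono ih i))
      · exact ⟨PMF.pure t, certainOf_pure (oppSet_mono ih i ht),
          NormalFormGame.rational_pure fun y => congrArg (G.util i) (hirr x y)⟩

end ExtensiveGame

theorem mainTheorem1 {N : Type u} {A : Type v} [Finite N] [Nonempty N] (G : ExtensiveGame N A)
    (hG : G.PerfectRecall)
    (b₁ : (i : N) → G.BeliefSystem i) (hb₁ : ∀ i, (b₁ i).FullSupport)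
    (β₁ : (i : N) → G.normalForm.Belief i) (hβ₁ : ∀ i, (β₁ i).support = Set.univ)
    (hcons : ∀ i, G.Consistent (b₁ i) (β₁ i)) (k : ℕ) (hk : 1 ≤ k) :
    G.outcomes {s | ∀ j, s j ∈ G.strongLevel b₁ k j} ⊆
      G.outcomes {s | ∀ j, s j ∈ G.normalForm.level β₁ k j} := by
  obtain ⟨k, rfl⟩ := Nat.exists_eq_add_of_le' hk
  rintro _ ⟨s, hs, rfl⟩
  exact ⟨s, fun j => hG.strongLevel_subset_level hb₁ hβ₁ hcons k j (hs j), rfl⟩
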